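/- Let $b\ge 2$ and $k\ge 1$ be integers, and let $b=p_1^{l_1}\cdots p_r^{l_r}$ with distinct primes $p_i$ and exponents $l_i\ge 1$, numbered so that $l_1(p_1-1)\ge l_2(p_2-1)\ge\cdots\ge l_r(p_r-1)$ and $p_1=\max\{p_i : l_i(p_i-1)=l_1(p_1-1)\}$. For an integer $m\ge 1$ let $\nu_b(m)$ be the largest integer $l$ with $b^l\mid m$, and let $\ell_{b,k}(m)=\frac{m}{b^{\nu_b(m)}} \bmod b^k\in\{0,\dots,b^k-1\}$; this is the number whose base-$b$ expansion is given by the $k$ last nonzero digits of $m$ (the last $k$ digits after removal of the trailing zeros, with leading zeros added if necessary). For an integer $a$ let $f_{b,k}(a)$ denote the asymptotic density of $A=\{n\ge 0:\ell_{b,k}(n!)=a\}$, i.e. $\lim_{n\to\infty}\frac{|A\cap\{1,\dots,n\}|}{n}$, if this limit exists. Assume that $l_1=1$, and let $a\in\{1,\dots,b^k-1\}$ be such that $b\nmid a$. Then $f_{b,k}(a)$ exists, and $$f_{b,k}(a)=\frac{1}{(p_1-1)\,p_1^{k-1}}\quad\text{if } (b/p_1)^k\mid a,$$ while $f_{b,k}(a)=0$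 otherwise. -/

import Mathlib

/-- `lastNonzeroDigits b k m` is the number whose base-`b` expansion is given by the `k` last nonzero
digits of `m` (that is, the last `k` digits of `m` after removal of its trailing zeros, with leading
zeros added if necessary): `m / b ^ ν_b(m) mod b ^ k`, where `ν_b(m) = multiplicity b m` is the
largest `l` such that `b ^ l ∣ m`. Here `b ≥ 2` need not be prime, and `m ≥ 1`. -/
noncomputable def lastNonzeroDigits (b k m : ℕ) : ℕ :=
  (m / b ^ multiplicity b m) % b ^ k

/-- The set `A` of natural numbers has asymptotic density `d`: the limit of
`|A ∩ {1, …, n}| / n` as `n → ∞` exists and equals `d`. -/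
def HasAsymptoticDensity (A : Set ℕ) (d : ℝ) : Prop :=
  Filter.Tendsto (fun n : ℕ => ((A ∩ Set.Icc 1 n).ncard : ℝ) / (n : ℝ)) Filter.atTop (nhds d)

/-- The value `a` has asymptotic frequency `f` in the sequence of the `k` last nonzero digits of `n!`
in base `b`. -/
def HasFactorialDigitFrequency (b k a : ℕ) (f : ℝ) : Prop :=
  HasAsymptoticDensity {n : ℕ | lastNonzeroDigits b k (Nat.factorial n) = a} f

/-- `p` is the prime `p₁` of the factorization `b = p₁ ^ l₁ ⋯ p_r ^ l_r`, numbered in such a way that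
`l₁ (p₁ - 1)` is the largest of the numbers `l_i (p_i - 1)` and `p₁` is the largest of the primes
`p_i` for which `l_i (p_i - 1) = l₁ (p₁ - 1)`. -/
structure IsLeadingPrime (b p : ℕ) : Prop where
  mem : p ∈ b.primeFactors
  le : ∀ q ∈ b.primeFactors, b.factorization q * (q - 1) ≤ b.factorization p * (p - 1)
  max : ∀ q ∈ b.primeFactors,
    b.factorization q * (q - 1) = b.factorization p * (p - 1) → q ≤ p

open Filter Topology Finset

/-! Write `p` for the leading prime, `u = b / p` (prime to `p`, since `p` has exponent one) and `V`
for the `p`-adic valuation of `n!`. The proof shows that for almost all `n` every other prime of `b`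
occurs in `n!` so often that `u ^ (V + k)` divides `n!`. Then `b` has multiplicity exactly `V`, and
`n! / b ^ V` is `0` modulo `u ^ k` and `(n! / p ^ V) * u⁻¹ ^ V` modulo `p ^ k`. By the Chinese
remainder theorem it remains to equidistribute the latter residue, `twistedUnitPart` with `v = u⁻¹`,
among the units modulo `p ^ k`.

Abundance of the other primes: Legendre's formula `(r - 1) v_r(n!) = n - s_r(n)`, with `s_r` the
digit sum, settles `l (q - 1) < p - 1` for all large `n`. In the case of equality `s_p(n) - s_q(n)`
must be large; as `q < p` and `(x - 1) / log x` increases, this holds for almost all `n` by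
Chebyshev's inequality (`digits_sum_lt_density_zero`).

Equidistribution: for a nontrivial character `χ`, put `F n = χ (twistedUnitPart p k v n!)`.
Appending a base-`p` digit multiplies `F` by a factor depending only on that digit and on `n` modulo
a fixed `M` (`char_factorial_digit_step`), so sums over `p`-adic blocks starting in the same class
are proportional. Each block contains two congruent indices with different values of `F`
(`exists_char_factorial_ne`); the resulting cancellation, iterated over scales, makes the mean value
zero (`block_sums_small`). -/

/-! ### Mean values from cancellation in blocks -/

/-- A bounded sequence whose sums over aligned blocks of some length `Q` are small relative to `Q`
has mean value zero. -/
theorem tendsto_mean_zero_of_block_sums {F : ℕ → ℂ} (hF : ∀ n, ‖F n‖ ≤ 1)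
    (h : ∀ ε : ℝ, 0 < ε → ∃ Q : ℕ, 0 < Q ∧ ∀ n, ‖∑ e ∈ range Q, F (n * Q + e)‖ ≤ ε * Q) :
    Tendsto (fun X : ℕ => (∑ n ∈ Icc 1 X, F n) / (X : ℂ)) atTop (𝓝 0) := by
  rw [Metric.tendsto_atTop]
  intro ε hε
  obtain ⟨Q, hQ, hb⟩ := h (ε / 2) (by positivity)
  have hmul : ∀ y : ℕ, ‖∑ n ∈ range (y * Q), F n‖ ≤ y * (ε / 2 * Q) := by
    intro y
    induction y with
    | zero => simp
    | succ y ih =>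
      rw [add_mul, one_mul, sum_range_add]
      refine (norm_add_le _ _).trans ?_
      push_cast
      linarith [hb y]
  have hbd : ∀ (s : Finset ℕ) (f : ℕ → ℕ), ‖∑ n ∈ s, F (f n)‖ ≤ #s := by
    intro s f
    refine (norm_sum_le _ _).trans ?_
    simpa using sum_le_sum (fun i _ => hF (f i))
  -- `Q` pays for the incomplete last block, `2` for passing from `Icc 1 X` to `range X`.
  have hX : ∀ X : ℕ, ‖∑ n ∈ Icc 1 X, F n‖ ≤ ε / 2 * X + (Q + 2) := by
    intro X
    have h1 : ∑ n ∈ Icc 1 X, F n = ∑ n ∈ range X, F n + F X - F 0 := by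
      rw [← sum_range_succ, sum_range_succ', add_sub_cancel_right, range_eq_Ico,
        sum_Ico_add' F 0 X 1]
      rfl
    have h2 : ‖∑ n ∈ range X, F n‖ ≤ ε / 2 * X + Q := by
      have h3 : X / Q * Q + X % Q = X := Nat.div_add_mod' X Q
      have h4 : ((X / Q : ℕ) : ℝ) * Q ≤ X := by exact_mod_cast Nat.div_mul_le_self X Q
      have h5 : ((X % Q : ℕ) : ℝ) ≤ Q := by exact_mod_cast (Nat.mod_lt X hQ).le
      conv_lhs => rw [← h3]
      rw [sum_range_add]
      refine (norm_add_le _ _).trans ?_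
      have h6 := hmul (X / Q)
      have h7 := hbd (range (X % Q)) (fun x => X / Q * Q + x)
      rw [card_range] at h7
      nlinarith
    rw [h1]
    have := norm_sub_le (∑ n ∈ range X, F n + F X) (F 0)
    have := norm_add_le (∑ n ∈ range X, F n) (F X)
    linarith [hF X, hF 0]
  obtain ⟨N, hN⟩ := exists_nat_gt ((Q + 2) / (ε / 2))
  refine ⟨N + 1, fun X hXN => ?_⟩
  have hX0 : (0 : ℝ) < X := by
    have : 0 < X := by omega
    exact_mod_cast this
  rw [dist_zero_right, norm_div, Complex.norm_natCast, div_lt_iff₀ hX0]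
  refine (hX X).trans_lt ?_
  have h1 : (N : ℝ) < X := by exact_mod_cast hXN
  have h2 := hN.trans h1
  rw [div_lt_iff₀ (by positivity)] at h2
  linarith

theorem sum_range_mul_eq {R : Type*} [AddCommMonoid R] (f : ℕ → R) (a c : ℕ) :
    ∑ e ∈ range (a * c), f e = ∑ d ∈ range a, ∑ e ∈ range c, f (d * c + e) := by
  induction a with
  | zero => simp
  | succ a ih => rw [add_mul, one_mul, sum_range_add, ih, sum_range_succ]

/-- If the unimodular sequence `F` evolves under appending a base-`p` digit in a way depending only
on the residue class modulo `M`, and takes within every aligned block of length `p ^ L` two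
uniformly distinct values in one residue class modulo `M`, then its block sums are small. -/
theorem block_sums_small {F : ℕ → ℂ} {p M L : ℕ} {δ : ℝ} (hp : 0 < p) (hF : ∀ n, ‖F n‖ = 1)
    (hδ : 0 < δ)
    (hstep : ∀ n n' r, r < p → n ≡ n' [MOD M] → F (n * p + r) * F n' = F (n' * p + r) * F n)
    (hsep : ∀ m, ∃ d < p ^ L, ∃ d' < p ^ L, d ≡ d' [MOD M] ∧ d ≠ d' ∧
      ‖F (m * p ^ L + d) + F (m * p ^ L + d')‖ ≤ 2 - δ) (ε : ℝ) (hε : 0 < ε) :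
    ∃ Q : ℕ, 0 < Q ∧ ∀ n, ‖∑ e ∈ range Q, F (n * Q + e)‖ ≤ ε * Q := by
  have hF0 : ∀ n, F n ≠ 0 := fun n => by
    rw [← norm_ne_zero_iff, hF]; exact one_ne_zero
  -- Iterating `hstep` over `N` appended digits: `F (n * p ^ N + e) / F n` depends only on `n`
  -- modulo `M`. Cross-multiplication avoids the quotients.
  have hper : ∀ N n n' e, n ≡ n' [MOD M] →
      e < p ^ N → F (n * p ^ N + e) * F n' = F (n' * p ^ N + e) * F n := by
    intro N
    induction N with
    | zero =>
      intro n n' e _ he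
      obtain rfl : e = 0 := by simpa using he
      simp [mul_comm]
    | succ N ih =>
      intro n n' e h he
      have h1 : ∀ x, x * p ^ (N + 1) + e = (x * p ^ N + e / p) * p + e % p := by
        intro x
        rw [add_mul, add_assoc, Nat.div_add_mod']
        ring
      have h2 : e / p < p ^ N := by
        rw [Nat.div_lt_iff_lt_mul hp, ← pow_succ]; exact he
      have h3 := ih n n' _ h h2
      have h4 := hstep (n * p ^ N + e / p) (n' * p ^ N + e / p) (e % p)
        (Nat.mod_lt _ hp) ((h.mul_right _).add_right _)
      rw [h1, h1]
      have h5 := hF0 (n * p ^ N + e / p)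
      have h6 := hF0 (n' * p ^ N + e / p)
      apply mul_right_cancel₀ h6
      calc _ = F ((n * p ^ N + e / p) * p + e % p) * F (n' * p ^ N + e / p) * F n' := by ring
        _ = _ := by
          rw [h4, mul_assoc, h3]; ring
  set S : ℕ → ℕ → ℂ := fun N n => ∑ e ∈ range (p ^ N), F (n * p ^ N + e) with hS
  have hSadd : ∀ N n, S (N + L) n = ∑ d ∈ range (p ^ L), S N (n * p ^ L + d) := by
    intro N n
    simp only [hS]
    rw [pow_add, mul_comm (p ^ N), sum_range_mul_eq]
    refine sum_congr rfl fun d _ => sum_congr rfl fun e _ => ?_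
    congr 1; ring
  have hSper : ∀ N n n', n ≡ n' [MOD M] → S N n * F n' = S N n' * F n := by
    intro N n n' h
    simp only [hS, sum_mul]
    exact sum_congr rfl fun e he => hper N n n' e h (mem_range.1 he)
  -- Congruent blocks have sums proportional to `F n` and `F n'`, so a gap between these two values
  -- persists at every scale `N`.
  have hSpair : ∀ N n n', n ≡ n' [MOD M] → ‖S N n + S N n'‖ = ‖S N n‖ * ‖F n + F n'‖ := by
    intro N n n' h
    have h1 : (S N n + S N n') * F n = S N n * (F n + F n') := by
      rw [add_mul, ← hSper N n n' h]; ring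
    have h2 := congrArg norm h1
    rwa [norm_mul, norm_mul, hF, mul_one] at h2
  have hL2 : (2 : ℝ) ≤ p ^ L := by
    obtain ⟨d, hd, d', hd', -, hne, -⟩ := hsep 0
    have : 2 ≤ p ^ L := by omega
    exact_mod_cast this
  have hδ2 : δ ≤ 2 := by
    obtain ⟨d, hd, d', hd', -, hne, h⟩ := hsep 0
    linarith [norm_nonneg (F (0 * p ^ L + d) + F (0 * p ^ L + d'))]
  -- Of the `p ^ L` sub-blocks, the pair `d`, `d'` contributes at most `2 - δ` times the previous
  -- bound and each other one at most that bound.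
  have hcontr : ∀ j n, ‖S (j * L) n‖ ≤ ((p : ℝ) ^ L - δ) ^ j := by
    intro j
    induction j with
    | zero => intro n; simp [hS, hF]
    | succ j ih =>
      intro n
      obtain ⟨d, hd, d', hd', hmod, hne, hs⟩ := hsep n
      rw [add_mul, one_mul, hSadd]
      set B := ((p : ℝ) ^ L - δ) ^ j with hB
      have hB0 : 0 ≤ B := (norm_nonneg _).trans (ih 0)
      have hd1 : d ∈ range (p ^ L) := mem_range.2 hd
      have hd2 : d' ∈ (range (p ^ L)).erase d := mem_erase.2 ⟨hne.symm, mem_range.2 hd'⟩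
      rw [← add_sum_erase _ _ hd1, ← add_sum_erase _ _ hd2, ← add_assoc]
      refine (norm_add_le _ _).trans ?_
      rw [hSpair _ _ _ (hmod.add_left _)]
      have h1 : ‖∑ x ∈ ((range (p ^ L)).erase d).erase d', S (j * L) (n * p ^ L + x)‖
          ≤ ((p : ℝ) ^ L - 2) * B := by
        refine (norm_sum_le _ _).trans ((sum_le_sum fun i _ => ih _).trans ?_)
        rw [sum_const, card_erase_of_mem hd2, card_erase_of_mem hd1, card_range, nsmul_eq_mul]
        have h3 : 2 ≤ p ^ L := by exact_mod_cast hL2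
        rw [Nat.sub_sub, Nat.cast_sub h3]
        push_cast
        exact le_rfl
      have h2 : ‖S (j * L) (n * p ^ L + d)‖ * ‖F (n * p ^ L + d) + F (n * p ^ L + d')‖
          ≤ B * (2 - δ) := mul_le_mul (ih _) hs (norm_nonneg _) hB0
      rw [pow_succ, ← hB]
      linarith
  have hpos : (0 : ℝ) < p ^ L := by linarith
  obtain ⟨j, hj⟩ := exists_pow_lt_of_lt_one hε
    (show ((p : ℝ) ^ L - δ) / p ^ L < 1 by rw [div_lt_one hpos]; linarith)
  refine ⟨p ^ (j * L), by positivity, fun n => (hcontr j n).trans ?_⟩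
  rw [div_pow, div_lt_iff₀ (by positivity)] at hj
  rw [mul_comm j L, pow_mul]
  push_cast
  exact hj.le

/-- Distinct unimodular complex numbers out of a finite set have sums bounded away from `2`. -/
theorem exists_gap_of_finite {s : Set ℂ} (hs : s.Finite) (h1 : ∀ z ∈ s, ‖z‖ = 1) :
    ∃ δ : ℝ, 0 < δ ∧ ∀ x ∈ s, ∀ y ∈ s, x ≠ y → ‖x + y‖ ≤ 2 - δ := by
  -- The extra `1` keeps the set nonempty when `s` has no two distinct points; otherwise strict
  -- convexity makes each element positive.
  have hfin : (insert 1 ((fun z : ℂ × ℂ => 2 - ‖z.1 + z.2‖) '' ((s ×ˢ s) ∩ {z | z.1 ≠ z.2}))).Finite :=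
    (((hs.prod hs).inter_of_left _).image _).insert _
  obtain ⟨δ, hδ, hmin⟩ := Set.exists_min_image _ id hfin ⟨1, Set.mem_insert _ _⟩
  refine ⟨δ, ?_, fun x hx y hy hxy => ?_⟩
  · rcases hδ with rfl | ⟨⟨x, y⟩, ⟨⟨hx, hy⟩, hxy⟩, rfl⟩
    · exact one_pos
    · have h2 : ¬ SameRay ℝ x y := by
        rwa [sameRay_iff_of_norm_eq ((h1 x hx).trans (h1 y hy).symm)]
      have h3 := norm_add_lt_of_not_sameRay h2
      rw [h1 x hx, h1 y hy] at h3
      dsimp only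
      linarith
  · have := hmin _ (Set.mem_insert_of_mem _ ⟨(x, y), ⟨⟨hx, hy⟩, hxy⟩, rfl⟩)
    simp only [id] at this
    linarith

/-- The product of a `T`-periodic sequence of `E`-th roots of unity over `E` periods is `1`. -/
theorem prod_range_mul_eq_one {ρ : ℕ → ℂ} {T E : ℕ} (hT : ∀ n, ρ (n + T) = ρ n)
    (hE : ∀ n, ρ n ^ E = 1) (n : ℕ) : ∏ i ∈ range (E * T), ρ (n + i) = 1 := by
  have h : ∀ e : ℕ, ∏ i ∈ range (e * T), ρ (n + i) = (∏ i ∈ range T, ρ (n + i)) ^ e := by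
    intro e
    induction e with
    | zero => simp
    | succ e ih =>
      rw [add_mul, one_mul, prod_range_add, ih, pow_succ]
      congr 1
      refine prod_congr rfl fun i _ => ?_
      have : ∀ e m, ρ (m + e * T) = ρ m := by
        intro e
        induction e with
        | zero => simp
        | succ e ih => intro m; rw [add_mul, one_mul, ← add_assoc, hT, ih]
      rw [← this e (n + i)]
      congr 1; ring
  rw [h, ← prod_pow]
  exact prod_eq_one fun i _ => hE _

/-! ### The twisted unit part, a completely multiplicative function -/

/-- The residue modulo `p ^ k` of `n / p ^ ν * v ^ ν`, where `ν` is the `p`-adic valuation of `n`. -/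
def twistedUnitPart (p k v n : ℕ) : ZMod (p ^ k) :=
  ((ordCompl[p] n : ℕ) : ZMod (p ^ k)) * (v : ZMod (p ^ k)) ^ n.factorization p

theorem natCast_isUnit_of_coprime {p k x : ℕ} (h : x.Coprime p) : IsUnit (x : ZMod (p ^ k)) :=
  (ZMod.isUnit_iff_coprime x (p ^ k)).2 (h.pow_right k)

theorem twistedUnitPart_isUnit {p k v n : ℕ} (hp : p.Prime) (hv : v.Coprime p) (hn : n ≠ 0) :
    IsUnit (twistedUnitPart p k v n) :=
  (natCast_isUnit_of_coprime (Nat.coprime_ordCompl hp hn).symm).mul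
    ((natCast_isUnit_of_coprime hv).pow _)

theorem twistedUnitPart_mul (p k v : ℕ) {m n : ℕ} (hm : m ≠ 0) (hn : n ≠ 0) :
    twistedUnitPart p k v (m * n) = twistedUnitPart p k v m * twistedUnitPart p k v n := by
  rw [twistedUnitPart, twistedUnitPart, twistedUnitPart, Nat.ordCompl_mul,
    Nat.factorization_mul hm hn, Finsupp.add_apply, pow_add, Nat.cast_mul]
  ring

theorem twistedUnitPart_of_coprime {p k v n : ℕ} (hp : p.Prime) (hn : n.Coprime p) :
    twistedUnitPart p k v n = n := by
  have h : n.factorization p = 0 :=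
    Nat.factorization_eq_zero_of_not_dvd ((hp.coprime_iff_not_dvd).1 hn.symm)
  simp [twistedUnitPart, h]

theorem twistedUnitPart_prime_pow {p : ℕ} (k v : ℕ) (hp : p.Prime) (J : ℕ) :
    twistedUnitPart p k v (p ^ J) = (v : ZMod (p ^ k)) ^ J := by
  simp [twistedUnitPart, hp.factorization_pow, Nat.div_self (pow_pos hp.pos J)]

theorem twistedUnitPart_prime_pow_mul {p k v x : ℕ} (hp : p.Prime) (hx : x.Coprime p) (J : ℕ) :
    twistedUnitPart p k v (p ^ J * x) = (v : ZMod (p ^ k)) ^ J * x := by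
  have hx0 : x ≠ 0 := by
    rintro rfl
    exact hp.one_lt.ne' (by simpa using hx)
  rw [twistedUnitPart_mul p k v (pow_ne_zero J hp.ne_zero) hx0, twistedUnitPart_prime_pow k v hp,
    twistedUnitPart_of_coprime hp hx]

theorem dirichletCharacter_norm_eq_one {q : ℕ} (χ : DirichletCharacter ℂ q) {x : ZMod q}
    (hx : IsUnit x) : ‖χ x‖ = 1 := by
  obtain ⟨u, rfl⟩ := hx
  exact χ.unit_norm_eq_one u

theorem dirichletCharacter_pow_totient {q : ℕ} (χ : DirichletCharacter ℂ q) {x : ZMod q}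
    (hx : IsUnit x) : χ x ^ q.totient = 1 := by
  obtain ⟨u, rfl⟩ := hx
  rw [← map_pow, ← Units.val_pow_eq_pow_val, ZMod.pow_totient, Units.val_one, map_one]

/-! ### Characters along the factorials -/

section

variable {p k v : ℕ} (χ : DirichletCharacter ℂ (p ^ k))

theorem char_factorial_succ (v n : ℕ) : χ (twistedUnitPart p k v (n + 1).factorial) =
    χ (twistedUnitPart p k v (n + 1)) * χ (twistedUnitPart p k v n.factorial) := by
  rw [Nat.factorial_succ, twistedUnitPart_mul p k v n.succ_ne_zero n.factorial_ne_zero, map_mul]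

theorem char_factorial_norm (hp : p.Prime) (hv : v.Coprime p) (n : ℕ) :
    ‖χ (twistedUnitPart p k v n.factorial)‖ = 1 :=
  dirichletCharacter_norm_eq_one χ (twistedUnitPart_isUnit hp hv n.factorial_ne_zero)

theorem coprime_mul_add {n r : ℕ} (hp : p.Prime) (h0 : 0 < r) (hr : r < p) :
    (n * p + r).Coprime p := by
  rw [Nat.coprime_mul_right_add_left]
  exact ((hp.coprime_iff_not_dvd).2 (Nat.not_dvd_of_pos_of_lt h0 hr)).symm

/-- The contribution to the factorial of the integers in `(n * p, n * p + r]`, for `r < p`. -/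
theorem char_factorial_mul_add (hp : p.Prime) (n : ℕ) {r : ℕ} (hr : r < p) :
    χ (twistedUnitPart p k v (n * p + r).factorial) =
      (∏ j ∈ range r, χ (((n * p + (j + 1) : ℕ) : ZMod (p ^ k)))) *
        χ (twistedUnitPart p k v (n * p).factorial) := by
  induction r with
  | zero => simp
  | succ r ih =>
    rw [← add_assoc, char_factorial_succ, ih (by omega), prod_range_succ, add_assoc (n * p) r 1,
      twistedUnitPart_of_coprime hp]
    · ring
    · exact coprime_mul_add hp (by simp) hr

/-- Only the last of `n * p + 1, …, n * p + p` is divisible by `p`, and it contributes `v` times the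
twisted unit part of `n + 1`. This is the self-similarity linking `F (n * p)` to `F n`. -/
theorem char_factorial_succ_mul (hp : p.Prime) (n : ℕ) :
    χ (twistedUnitPart p k v ((n + 1) * p).factorial) =
      χ v * χ (twistedUnitPart p k v (n + 1)) *
      (∏ j ∈ range (p - 1), χ (((n * p + (j + 1) : ℕ) : ZMod (p ^ k)))) *
        χ (twistedUnitPart p k v (n * p).factorial) := by
  have h1 : (n + 1) * p = (n * p + (p - 1)) + 1 := by
    have := hp.pos
    rw [add_mul]; omega
  have h2 : twistedUnitPart p k v ((n + 1) * p) = v * twistedUnitPart p k v (n + 1) := by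
    rw [mul_comm, twistedUnitPart_mul p k v hp.ne_zero n.succ_ne_zero]
    congr 1
    simpa using twistedUnitPart_prime_pow k v hp 1
  rw [h1, char_factorial_succ, ← h1, h2, char_factorial_mul_add χ hp n (by have := hp.pos; omega),
    map_mul]
  ring

/-- `F (n * p) / F n` is a product of `ρ i` over `i < n`, up to a constant, where `ρ` has period `p
^ k` and its values are roots of unity of order dividing `φ(p ^ k)`. Hence it has period `φ(p ^ k) *
p ^ k`; the last digit `r` adds a factor of period `p ^ k`. -/
theorem char_factorial_digit_step (hp : p.Prime) (hv : v.Coprime p) {n n' : ℕ}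
    (h : n ≡ n' [MOD (p ^ k).totient * p ^ k]) {r : ℕ} (hr : r < p) :
    χ (twistedUnitPart p k v (n * p + r).factorial) * χ (twistedUnitPart p k v n'.factorial) =
      χ (twistedUnitPart p k v (n' * p + r).factorial) * χ (twistedUnitPart p k v n.factorial) := by
  set F : ℕ → ℂ := fun n => χ (twistedUnitPart p k v n.factorial) with hF
  have hF0 : ∀ n, F n ≠ 0 := fun n => by
    rw [← norm_ne_zero_iff, hF, char_factorial_norm χ hp hv]; exact one_ne_zero
  set ρ : ℕ → ℂ := fun n =>
    χ v * ∏ j ∈ range (p - 1), χ (((n * p + (j + 1) : ℕ) : ZMod (p ^ k))) with hρ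
  have hρper : ∀ n, ρ (n + p ^ k) = ρ n := by
    intro n
    simp only [hρ]
    congr 1
    refine prod_congr rfl fun j _ => ?_
    congr 1
    push_cast
    rw [← Nat.cast_pow, ZMod.natCast_self, add_zero]
  have hρE : ∀ n, ρ n ^ (p ^ k).totient = 1 := by
    intro n
    simp only [hρ, mul_pow, ← prod_pow]
    rw [dirichletCharacter_pow_totient χ (natCast_isUnit_of_coprime hv), one_mul]
    refine prod_eq_one fun j hj => dirichletCharacter_pow_totient χ (natCast_isUnit_of_coprime ?_)
    exact coprime_mul_add hp (by omega) (by rw [mem_range] at hj; omega)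
  have hstep : ∀ n, F ((n + 1) * p) * F n = ρ n * (F (n * p) * F (n + 1)) := by
    intro n
    simp only [hF, hρ]
    rw [char_factorial_succ_mul χ hp, char_factorial_succ χ v n]
    ring
  have hmany : ∀ c n, F ((n + c) * p) * F n =
      (∏ i ∈ range c, ρ (n + i)) * (F (n * p) * F (n + c)) := by
    intro c n
    induction c with
    | zero => simp
    | succ c ih =>
      apply mul_right_cancel₀ (hF0 (n + c))
      calc _ = F ((n + c + 1) * p) * F (n + c) * F n := by ring_nf
        _ = ρ (n + c) * F (n + (c + 1)) * (F ((n + c) * p) * F n) := by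
          rw [hstep]; ring_nf
        _ = _ := by rw [ih, prod_range_succ]; ring
  have hzero : ∀ c n, F ((n + c * ((p ^ k).totient * p ^ k)) * p) * F n =
      F (n * p) * F (n + c * ((p ^ k).totient * p ^ k)) := by
    intro c n
    rw [hmany]
    have : ∀ n, ρ (n + c * p ^ k) = ρ n := by
      intro n
      induction c with
      | zero => simp
      | succ c ih => rw [add_mul, one_mul, ← add_assoc, hρper, ih]
    have h2 : c * ((p ^ k).totient * p ^ k) = (p ^ k).totient * (c * p ^ k) := by ring
    rw [h2, prod_range_mul_eq_one this hρE, one_mul]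
  have hkey : ∀ c n, F ((n + c * ((p ^ k).totient * p ^ k)) * p + r) * F n =
      F (n * p + r) * F (n + c * ((p ^ k).totient * p ^ k)) := by
    intro c n
    have h1 : ∏ j ∈ range r, χ ((((n + c * ((p ^ k).totient * p ^ k)) * p + (j + 1) : ℕ) :
        ZMod (p ^ k))) = ∏ j ∈ range r, χ (((n * p + (j + 1) : ℕ) : ZMod (p ^ k))) := by
      refine prod_congr rfl fun j _ => ?_
      congr 1
      have : (p : ZMod (p ^ k)) ^ k = 0 := by rw [← Nat.cast_pow, ZMod.natCast_self]
      push_cast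
      rw [this]; ring
    have h2 := hzero c n
    simp only [hF] at h2 ⊢
    rw [char_factorial_mul_add χ hp _ hr, char_factorial_mul_add χ hp n hr, h1, mul_assoc, h2]
    ring
  rcases le_total n n' with hle | hle
  · obtain ⟨c, hc⟩ := (Nat.modEq_iff_dvd' hle).1 h
    have := hkey c n
    rw [mul_comm c, ← hc, Nat.add_sub_cancel' hle] at this
    exact this.symm
  · obtain ⟨c, hc⟩ := (Nat.modEq_iff_dvd' hle).1 h.symm
    have := hkey c n'
    rw [mul_comm c, ← hc, Nat.add_sub_cancel' hle] at this
    exact this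

/-- The valuation `t` of `M` is below that of `c`, and after division by `p ^ t` the term from `c`
vanishes modulo `p ^ k`: the value does not depend on `x`. -/
theorem twistedUnitPart_prime_pow_mul_add {x c t M : ℕ} (v : ℕ) (hp : p.Prime) (hM : M ≠ 0)
    (ht : M.factorization p = t) (hk : 1 ≤ k) (hx : c = p ^ (t + k) * x) :
    twistedUnitPart p k v (c + M) = (v : ZMod (p ^ k)) ^ t * (ordCompl[p] M : ℕ) := by
  have h1 : c + M = p ^ t * (p ^ k * x + ordCompl[p] M) := by
    rw [hx, mul_add, ← ht, Nat.ordProj_mul_ordCompl_eq_self]; ring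
  rw [h1, twistedUnitPart_prime_pow_mul hp]
  · push_cast
    rw [← Nat.cast_pow p k, ZMod.natCast_self, zero_mul, zero_add]
  · obtain ⟨k, rfl⟩ := Nat.exists_eq_add_of_le' hk
    rw [pow_succ, mul_assoc, mul_left_comm, Nat.coprime_mul_left_add_left]
    exact (Nat.coprime_ordCompl hp hM).symm

/-- If `F` were constant on residue classes modulo `M` within a block, successive quotients would
show that `χ` of the twisted unit part is unchanged by the shift by `M`. At multiples `p ^ (t + k) *
y` with `y` a unit, one side varies as `χ y` while the other is independent of `y`, forcing `χ = 1`.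
-/
theorem exists_char_factorial_ne (hp : p.Prime) (hv : v.Coprime p) (hk : 1 ≤ k) (hχ : χ ≠ 1)
    {M : ℕ} (hM : M ≠ 0) : ∃ L, ∀ m, ∃ d < p ^ L, ∃ d' < p ^ L, d ≡ d' [MOD M] ∧
      χ (twistedUnitPart p k v (m * p ^ L + d).factorial) ≠
        χ (twistedUnitPart p k v (m * p ^ L + d').factorial) := by
  obtain ⟨t, ht⟩ : ∃ t, M.factorization p = t := ⟨_, rfl⟩
  -- This leaves room for `p ^ (t + k) * y + M < p ^ L` whenever `y < p ^ k`, as `M < p ^ M`; it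
  -- also makes the block's offset vanish modulo `p ^ k` after division by `p ^ (t + k)`.
  refine ⟨(t + k) + (k + M), fun m => ?_⟩
  by_contra! hcon
  apply hχ
  set L := (t + k) + (k + M) with hL
  have hF0 : ∀ n : ℕ, χ (twistedUnitPart p k v n.factorial) ≠ 0 := fun n => by
    rw [← norm_ne_zero_iff, char_factorial_norm χ hp hv]; exact one_ne_zero
  have hH : ∀ i, i + M + 1 < p ^ L → χ (twistedUnitPart p k v (m * p ^ L + (i + 1))) =
      χ (twistedUnitPart p k v (m * p ^ L + (i + 1) + M)) := by
    intro i hi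
    have e1 := hcon i (by omega) (i + M) (by omega) (by simp [Nat.ModEq])
    have e2 := hcon (i + 1) (by omega) (i + 1 + M) (by omega) (by simp [Nat.ModEq])
    have e3 : m * p ^ L + (i + 1 + M) = m * p ^ L + (i + M) + 1 := by ring
    rw [e3, ← add_assoc, char_factorial_succ, char_factorial_succ, e1] at e2
    have e4 := mul_right_cancel₀ (hF0 _) e2
    rw [← add_assoc, e4]
    congr 2; ring
  have hconst : ∀ y, y.Coprime p → y < p ^ k →
      χ v ^ (t + k) * χ (y : ZMod (p ^ k)) = χ v ^ t * χ ((ordCompl[p] M : ℕ) : ZMod (p ^ k)) := by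
    intro y hy hyk
    have hy0 : y ≠ 0 := by
      rintro rfl
      exact hp.one_lt.ne' (by simpa using hy)
    have hpos : 0 < p ^ (t + k) * y := by
      have := hp.pos
      positivity
    have hlt : p ^ (t + k) * y + M < p ^ L := by
      have h1 : M < p ^ M := Nat.lt_pow_self hp.one_lt
      have h2 : 1 ≤ p ^ (t + k) := Nat.one_le_pow _ _ hp.pos
      calc p ^ (t + k) * y + M ≤ p ^ (t + k) * (y + M) := by
            rw [mul_add]; gcongr; exact Nat.le_mul_of_pos_left M h2
        _ < p ^ (t + k) * (p ^ k * p ^ M) := by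
            gcongr
            have h3 : 1 ≤ p ^ k := Nat.one_le_pow _ _ hp.pos
            nlinarith
        _ = p ^ L := by rw [hL, pow_add p (t + k), pow_add p k M]
    obtain ⟨i, hi⟩ : ∃ i, p ^ (t + k) * y = i + 1 := ⟨_, (Nat.succ_pred_eq_of_pos hpos).symm⟩
    have h1 := hH i (by omega)
    have h2 : m * p ^ L + (i + 1) = p ^ (t + k) * (m * p ^ (k + M) + y) := by
      rw [← hi, hL, pow_add p (t + k) (k + M)]; ring
    have h3 : (m * p ^ (k + M) + y).Coprime p := by
      obtain ⟨j, rfl⟩ := Nat.exists_eq_add_of_le' hk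
      have : m * p ^ (j + 1 + M) + y = m * p ^ (j + M) * p + y := by ring
      rw [this, Nat.coprime_mul_right_add_left]
      exact hy
    rw [twistedUnitPart_prime_pow_mul_add v hp hM ht hk h2, h2,
      twistedUnitPart_prime_pow_mul hp h3, map_mul, map_mul, map_pow, map_pow] at h1
    rw [← h1]
    congr 2
    push_cast
    rw [pow_add, ← Nat.cast_pow p k, ZMod.natCast_self]
    ring
  have hone : ∀ y : ℕ, y.Coprime p → y < p ^ k → χ (y : ZMod (p ^ k)) = 1 := by
    intro y hy hyk
    have h1 := hconst y hy hyk
    have h2 := hconst 1 (by simp) (Nat.one_lt_pow (by omega) hp.one_lt)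
    rw [← h2] at h1
    have h3 : χ v ^ (t + k) ≠ 0 := by
      apply pow_ne_zero
      rw [← norm_ne_zero_iff, dirichletCharacter_norm_eq_one χ (natCast_isUnit_of_coprime hv)]
      exact one_ne_zero
    simpa using mul_left_cancel₀ h3 h1
  have : NeZero (p ^ k) := ⟨pow_ne_zero k hp.ne_zero⟩
  ext u
  have h1 := hone (u : ZMod (p ^ k)).val
    (Nat.Coprime.coprime_dvd_right (dvd_pow_self p (by omega)) (ZMod.val_coe_unit_coprime u))
    (ZMod.val_lt _)
  rw [ZMod.natCast_zmod_val] at h1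
  rw [h1, MulChar.one_apply_coe]

/-- Nontrivial Dirichlet characters modulo `p ^ k` have mean value zero along the twisted unit parts
of the factorials. -/
theorem char_factorial_mean_zero (hp : p.Prime) (hv : v.Coprime p) (hk : 1 ≤ k) (hχ : χ ≠ 1) :
    Tendsto (fun X : ℕ => (∑ n ∈ Icc 1 X, χ (twistedUnitPart p k v n.factorial)) / (X : ℂ))
      atTop (𝓝 0) := by
  have : NeZero (p ^ k) := ⟨pow_ne_zero k hp.ne_zero⟩
  refine tendsto_mean_zero_of_block_sums (fun n => (char_factorial_norm χ hp hv n).le) ?_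
  have hM : (p ^ k).totient * p ^ k ≠ 0 :=
    mul_ne_zero (Nat.totient_pos.2 (pow_pos hp.pos k)).ne' (pow_ne_zero k hp.ne_zero)
  obtain ⟨L, hL⟩ := exists_char_factorial_ne χ hp hv hk hχ hM
  obtain ⟨δ, hδ, hgap⟩ := exists_gap_of_finite
    (s := Set.range fun n : ℕ => χ (twistedUnitPart p k v n.factorial))
    ((Set.finite_range χ).subset (by rintro _ ⟨n, rfl⟩; exact ⟨_, rfl⟩))
    (by rintro _ ⟨n, rfl⟩; exact char_factorial_norm χ hp hv n)
  refine block_sums_small (L := L) hp.pos (char_factorial_norm χ hp hv) hδ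
    (fun n n' r hr h => char_factorial_digit_step χ hp hv h hr) fun m => ?_
  obtain ⟨d, hd, d', hd', hmod, hne⟩ := hL m
  exact ⟨d, hd, d', hd', hmod, by rintro rfl; exact hne rfl, hgap _ ⟨_, rfl⟩ _ ⟨_, rfl⟩ hne⟩

end

/-! ### From mean values to densities -/

theorem ncard_inter_Icc (A : Set ℕ) [DecidablePred (· ∈ A)] (n : ℕ) :
    (A ∩ Set.Icc 1 n).ncard = #{m ∈ Icc 1 n | m ∈ A} := by
  rw [← Set.ncard_coe_finset]
  congr 1
  ext m
  simp only [Set.mem_inter_iff, Set.mem_Icc, coe_filter, mem_Icc, Set.mem_ofPred_eq, and_comm]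

/-- The twisted unit parts of the factorials are equidistributed among the units. -/
theorem hasAsymptoticDensity_twistedUnitPart {p k v : ℕ} (hp : p.Prime) (hv : v.Coprime p)
    (hk : 1 ≤ k) {a : ZMod (p ^ k)} (ha : IsUnit a) :
    HasAsymptoticDensity {n | twistedUnitPart p k v n.factorial = a}
      (1 / ((p ^ k).totient : ℝ)) := by
  classical
  have : NeZero (p ^ k) := ⟨pow_ne_zero k hp.ne_zero⟩
  have hφ : ((p ^ k).totient : ℂ) ≠ 0 := by
    exact_mod_cast (Nat.totient_pos.2 (pow_pos hp.pos k)).ne'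
  have hone : Tendsto (fun X : ℕ => (∑ n ∈ Icc 1 X,
      (1 : DirichletCharacter ℂ (p ^ k)) (twistedUnitPart p k v n.factorial)) / (X : ℂ))
      atTop (𝓝 1) := by
    refine tendsto_const_nhds.congr' ?_
    filter_upwards [eventually_gt_atTop 0] with X hX
    rw [sum_congr rfl fun n _ => MulChar.one_apply (R := ZMod (p ^ k)) (R' := ℂ)
      (twistedUnitPart_isUnit hp hv n.factorial_ne_zero)]
    have : (X : ℂ) ≠ 0 := by exact_mod_cast hX.ne'
    simp [div_self this]
  have hall : ∀ χ : DirichletCharacter ℂ (p ^ k), Tendsto (fun X : ℕ => χ a⁻¹ * ((∑ n ∈ Icc 1 X,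
      χ (twistedUnitPart p k v n.factorial)) / (X : ℂ))) atTop (𝓝 (if χ = 1 then 1 else 0)) := by
    intro χ
    split_ifs with h
    · subst h
      have ha' : IsUnit a⁻¹ := by
        obtain ⟨u, rfl⟩ := ha
        rw [ZMod.inv_coe_unit]
        exact u⁻¹.isUnit
      rw [MulChar.one_apply ha']
      simpa using hone
    · simpa using (char_factorial_mean_zero χ hp hv hk h).const_mul (χ a⁻¹)
  have hsum := (tendsto_finsetSum univ fun χ _ => hall χ).div_const ((p ^ k).totient : ℂ)
  rw [sum_ite_eq' univ, if_pos (mem_univ _)] at hsum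
  rw [HasAsymptoticDensity]
  have hre := (Complex.continuous_re.tendsto _).comp hsum
  have h1 : (1 / ((p ^ k).totient : ℂ)).re = 1 / ((p ^ k).totient : ℝ) := by
    rw [← Complex.ofReal_natCast, ← Complex.ofReal_one, ← Complex.ofReal_div, Complex.ofReal_re]
  rw [h1] at hre
  refine hre.congr fun X => ?_
  have h2 : (∑ χ : DirichletCharacter ℂ (p ^ k), χ a⁻¹ * ((∑ n ∈ Icc 1 X,
      χ (twistedUnitPart p k v n.factorial)) / (X : ℂ))) / ((p ^ k).totient : ℂ) =
      ((#{m ∈ Icc 1 X | twistedUnitPart p k v m.factorial = a} : ℝ) / (X : ℝ) : ℝ) := by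
    -- Orthogonality of characters detects the residue `a`.
    have h3 : ∑ χ : DirichletCharacter ℂ (p ^ k), χ a⁻¹ * (∑ n ∈ Icc 1 X,
      χ (twistedUnitPart p k v n.factorial)) =
      (#{m ∈ Icc 1 X | twistedUnitPart p k v m.factorial = a} : ℂ) * (p ^ k).totient := by
      simp_rw [mul_sum]
      rw [sum_comm, card_filter, Nat.cast_sum, sum_mul]
      refine sum_congr rfl fun n _ => ?_
      rw [DirichletCharacter.sum_char_inv_mul_char_eq ℂ ha]
      simp only [eq_comm (a := a)]
      split_ifs <;> simp
    simp_rw [← mul_div_assoc]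
    rw [← sum_div, h3]
    push_cast
    field_simp
  simp only [Function.comp_apply]
  rw [h2, Complex.ofReal_re, ncard_inter_Icc]
  rfl

/-! ### Sets of density zero -/

theorem ncard_inter_Icc_mono {A B : Set ℕ} {n : ℕ} (h : ∀ m ∈ Set.Icc 1 n, m ∈ A → m ∈ B) :
    (A ∩ Set.Icc 1 n).ncard ≤ (B ∩ Set.Icc 1 n).ncard :=
  Set.ncard_le_ncard (fun m hm => ⟨h m hm.2 hm.1, hm.2⟩) ((Set.finite_Icc 1 n).inter_of_right B)

theorem ncard_inter_Icc_union_le (A B : Set ℕ) (n : ℕ) :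
    ((A ∪ B) ∩ Set.Icc 1 n).ncard ≤ (A ∩ Set.Icc 1 n).ncard + (B ∩ Set.Icc 1 n).ncard := by
  rw [Set.union_inter_distrib_right]
  exact Set.ncard_union_le _ _

theorem hasAsymptoticDensity_zero_of_le {A : Set ℕ} {f : ℕ → ℝ} (hf : Tendsto f atTop (𝓝 0))
    (h : ∀ᶠ n : ℕ in atTop, ((A ∩ Set.Icc 1 n).ncard : ℝ) ≤ f n * n) :
    HasAsymptoticDensity A 0 := by
  refine squeeze_zero' (Eventually.of_forall fun n => by positivity) ?_ hf
  filter_upwards [h, eventually_gt_atTop 0] with n hn hn0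
  have : (0 : ℝ) < n := by exact_mod_cast hn0
  rwa [div_le_iff₀ this]

theorem HasAsymptoticDensity.mono_zero {A B : Set ℕ} (hB : HasAsymptoticDensity B 0) (h : A ⊆ B) :
    HasAsymptoticDensity A 0 := by
  refine squeeze_zero (fun n => by positivity) (fun n => ?_) hB
  exact div_le_div_of_nonneg_right
    (by exact_mod_cast ncard_inter_Icc_mono fun m _ hm => h hm) n.cast_nonneg

theorem HasAsymptoticDensity.union_zero {A B : Set ℕ} (hA : HasAsymptoticDensity A 0)
    (hB : HasAsymptoticDensity B 0) : HasAsymptoticDensity (A ∪ B) 0 := by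
  have h : Tendsto (fun n : ℕ => ((A ∩ Set.Icc 1 n).ncard : ℝ) / (n : ℝ) +
      ((B ∩ Set.Icc 1 n).ncard : ℝ) / (n : ℝ)) atTop (𝓝 0) := by
    simpa using Filter.Tendsto.add hA hB
  refine squeeze_zero (fun n => by positivity) (fun n => ?_) h
  rw [← add_div]
  gcongr
  exact_mod_cast ncard_inter_Icc_union_le A B n

theorem Set.Finite.hasAsymptoticDensity_zero {A : Set ℕ} (hA : A.Finite) :
    HasAsymptoticDensity A 0 := by
  refine squeeze_zero (fun n => by positivity) (fun n => ?_)
    (tendsto_const_div_atTop_nhds_zero_nat (A.ncard : ℝ))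
  exact div_le_div_of_nonneg_right
    (by exact_mod_cast Set.ncard_le_ncard Set.inter_subset_left hA) n.cast_nonneg

theorem hasAsymptoticDensity_zero_biUnion {ι : Type*} (s : Finset ι) (A : ι → Set ℕ)
    (h : ∀ i ∈ s, HasAsymptoticDensity (A i) 0) : HasAsymptoticDensity (⋃ i ∈ s, A i) 0 := by
  classical
  induction s using Finset.induction_on with
  | empty => simpa using Set.finite_empty.hasAsymptoticDensity_zero
  | insert i s _ ih =>
    rw [Finset.set_biUnion_insert]
    exact (h i (mem_insert_self i s)).union_zero (ih fun j hj => h j (mem_insert_of_mem hj))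

/-- Changing a set on a set of density zero does not affect its asymptotic density. -/
theorem HasAsymptoticDensity.congr_off_null {A B N : Set ℕ} {d : ℝ} (hB : HasAsymptoticDensity B d)
    (hN : HasAsymptoticDensity N 0) (h : ∀ n, n ∉ N → (n ∈ A ↔ n ∈ B)) :
    HasAsymptoticDensity A d := by
  have hdiff : Tendsto (fun n : ℕ => ((A ∩ Set.Icc 1 n).ncard : ℝ) / (n : ℝ) -
      ((B ∩ Set.Icc 1 n).ncard : ℝ) / (n : ℝ)) atTop (𝓝 0) := by
    refine squeeze_zero_norm (fun n => ?_) hN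
    rw [← sub_div, norm_div, Real.norm_natCast]
    gcongr
    have key : ∀ A B : Set ℕ, (∀ n, n ∉ N → (n ∈ A → n ∈ B)) →
        ((A ∩ Set.Icc 1 n).ncard : ℝ) ≤ (B ∩ Set.Icc 1 n).ncard + (N ∩ Set.Icc 1 n).ncard := by
      intro A B h
      have h1 : A ⊆ B ∪ N := fun m hm => by
        by_cases hmN : m ∈ N
        · exact Or.inr hmN
        · exact Or.inl (h m hmN hm)
      exact_mod_cast (ncard_inter_Icc_mono fun m _ hm => h1 hm).trans
        (ncard_inter_Icc_union_le B N n)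
    rw [Real.norm_eq_abs, abs_le]
    constructor
    · linarith [key B A fun n hn => (h n hn).2]
    · linarith [key A B fun n hn => (h n hn).1]
  have := hdiff.add hB
  simpa [HasAsymptoticDensity] using this

/-! ### Concentration of digit sums and comparison of two bases -/

theorem digits_sum_mul_add {p : ℕ} (hp : 1 < p) (m : ℕ) {r : ℕ} (hr : r < p) :
    (Nat.digits p (m * p + r)).sum = (Nat.digits p m).sum + r := by
  rcases Nat.eq_zero_or_pos (m * p + r) with h | h
  · have h1 : r = 0 := by omega
    have h2 : m * p = 0 := by omega
    have h3 : m = 0 := by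
      rcases Nat.mul_eq_zero.1 h2 with h | h <;> omega
    subst h1 h3; simp
  · have h0 : 0 < p := by omega
    rw [Nat.digits_def' hp h, List.sum_cons, add_comm (m * p), Nat.add_mul_mod_self_right,
      Nat.mod_eq_of_lt hr,
      Nat.add_mul_div_right _ _ h0, Nat.div_eq_of_lt hr, zero_add, add_comm]

/-- Digits behave as independent uniform variables: when one is appended the cross term vanishes
because `r - μ` sums to zero, so variances add, each bounded crudely by `p ^ 2`. -/
theorem digits_sum_second_moment {p : ℕ} (hp : 1 < p) (K : ℕ) :
    ∑ n ∈ range (p ^ K), (((Nat.digits p n).sum : ℝ) - K * (((p : ℝ) - 1) / 2)) ^ 2 ≤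
      (p : ℝ) ^ K * (K * (p : ℝ) ^ 2) := by
  have hp1 : (1 : ℝ) < p := by exact_mod_cast hp
  set μ : ℝ := ((p : ℝ) - 1) / 2 with hμ
  have h1 : ∑ r ∈ range p, ((r : ℝ) - μ) = 0 := by
    have h2 : (∑ r ∈ range p, (r : ℝ)) * 2 = p * ((p : ℝ) - 1) := by
      have := Finset.sum_range_id_mul_two p
      have h3 : ((p - 1 : ℕ) : ℝ) = p - 1 := by rw [Nat.cast_sub hp.le, Nat.cast_one]
      rw [← h3]
      rw [← Nat.cast_sum]
      exact_mod_cast this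
    rw [sum_sub_distrib, sum_const, card_range, nsmul_eq_mul, hμ]
    linarith
  have h2 : ∑ r ∈ range p, ((r : ℝ) - μ) ^ 2 ≤ p * (p : ℝ) ^ 2 := by
    refine (sum_le_card_nsmul (range p) _ ((p : ℝ) ^ 2) fun r hr => ?_).trans (by simp)
    have h3 : (r : ℝ) < p := by exact_mod_cast mem_range.1 hr
    have h4 : (0 : ℝ) ≤ r := by positivity
    rw [sq_le_sq, abs_of_pos (by linarith : (0 : ℝ) < p), abs_le]
    constructor <;> linarith
  induction K with
  | zero => simp
  | succ K ih =>
    rw [pow_succ p K, sum_range_mul_eq]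
    have h3 : ∀ m, ∑ r ∈ range p,
        (((Nat.digits p (m * p + r)).sum : ℝ) - ((K + 1 : ℕ) : ℝ) * μ) ^ 2 =
        p * (((Nat.digits p m).sum : ℝ) - K * μ) ^ 2 + ∑ r ∈ range p, ((r : ℝ) - μ) ^ 2 := by
      intro m
      have h4 : ∀ r ∈ range p,
          (((Nat.digits p (m * p + r)).sum : ℝ) - ((K + 1 : ℕ) : ℝ) * μ) ^ 2 =
          (((Nat.digits p m).sum : ℝ) - K * μ) ^ 2 +
          2 * (((Nat.digits p m).sum : ℝ) - K * μ) * ((r : ℝ) - μ) + ((r : ℝ) - μ) ^ 2 := by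
        intro r hr
        rw [digits_sum_mul_add hp m (mem_range.1 hr)]
        push_cast
        ring
      rw [sum_congr rfl h4, sum_add_distrib, sum_add_distrib, ← mul_sum, h1]
      simp
    rw [sum_congr rfl fun m _ => h3 m, sum_add_distrib, ← mul_sum, sum_const, card_range,
      nsmul_eq_mul]
    have hpK : (0 : ℝ) < (p : ℝ) ^ K := by positivity
    rw [Nat.cast_pow]
    calc _ ≤ (p : ℝ) * ((p : ℝ) ^ K * (K * (p : ℝ) ^ 2)) + (p : ℝ) ^ K * (p * (p : ℝ) ^ 2) := by
          gcongr
      _ = _ := by push_cast; ring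

/-- Chebyshev's inequality for the sum of digits of the integers in `[0, p ^ K)`. -/
theorem digits_sum_chebyshev {p : ℕ} (hp : 1 < p) {K : ℕ} (hK : 0 < K) {η : ℝ} (hη : 0 < η) :
    (#{n ∈ range (p ^ K) | η * K ≤ |((Nat.digits p n).sum : ℝ) - K * (((p : ℝ) - 1) / 2)|} : ℝ) ≤
      (p : ℝ) ^ K * ((p : ℝ) ^ 2 / (η ^ 2 * K)) := by
  have hK0 : (0 : ℝ) < K := by exact_mod_cast hK
  have h1 := digits_sum_second_moment hp K
  set s := {n ∈ range (p ^ K) | η * K ≤ |((Nat.digits p n).sum : ℝ) - K * (((p : ℝ) - 1) / 2)|}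
  have h2 : #s • (η * K) ^ 2 ≤
      ∑ n ∈ s, (((Nat.digits p n).sum : ℝ) - K * (((p : ℝ) - 1) / 2)) ^ 2 := by
    refine card_nsmul_le_sum _ _ _ fun n hn => ?_
    rw [sq_le_sq, abs_of_pos (by positivity : (0 : ℝ) < η * K)]
    exact (mem_filter.1 hn).2
  have h3 := h2.trans ((sum_le_sum_of_subset_of_nonneg (filter_subset _ _)
    fun _ _ _ => sq_nonneg _).trans h1)
  rw [nsmul_eq_mul] at h3
  have h4 : (p : ℝ) ^ K * ((p : ℝ) ^ 2 / (η ^ 2 * K)) =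
      (p : ℝ) ^ K * (K * (p : ℝ) ^ 2) / (η * K) ^ 2 := by
    field_simp
  rwa [h4, le_div_iff₀ (by positivity)]

theorem tendsto_natLog_atTop {q : ℕ} (hq : 1 < q) : Tendsto (Nat.log q) atTop atTop :=
  tendsto_atTop_atTop.2 fun b => ⟨q ^ b, fun _ h => Nat.le_log_of_pow_le hq h⟩

/-- The integers up to `X` whose digit sum deviates by at least `η * K` from its mean value for
`K`-digit integers, where `K` is the number of digits of `X`. -/
theorem digits_sum_deviation_count {p : ℕ} (hp : 1 < p) {X : ℕ} (hX : X ≠ 0) {η : ℝ} (hη : 0 < η) :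
    (({n : ℕ | η * (Nat.log p X + 1 : ℕ) ≤ |((Nat.digits p n).sum : ℝ) -
      (Nat.log p X + 1 : ℕ) * (((p : ℝ) - 1) / 2)|} ∩ Set.Icc 1 X).ncard : ℝ) ≤
      ((p : ℝ) ^ 3 / η ^ 2 / (Nat.log p X + 1 : ℕ)) * X := by
  have h1 := digits_sum_chebyshev hp (Nat.succ_pos (Nat.log p X)) hη
  refine (le_trans ?_ h1).trans ?_
  · rw [← Set.ncard_coe_finset]
    refine Nat.cast_le.2 (Set.ncard_le_ncard ?_ (Finset.finite_toSet _))
    intro n hn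
    rw [mem_coe, mem_filter, mem_range]
    exact ⟨lt_of_le_of_lt hn.2.2 (Nat.lt_pow_succ_log_self hp X), hn.1⟩
  -- Rounding `X` up to a power of `p` costs a factor of at most `p`, whence `p ^ 3`.
  · have h2 : ((p ^ Nat.log p X : ℕ) : ℝ) ≤ X := by exact_mod_cast Nat.pow_log_le_self p hX
    push_cast at h2 ⊢
    rw [pow_succ]
    calc (p : ℝ) ^ Nat.log p X * p * ((p : ℝ) ^ 2 / (η ^ 2 * (Nat.log p X + 1)))
        ≤ X * p * ((p : ℝ) ^ 2 / (η ^ 2 * (Nat.log p X + 1))) := by gcongr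
      _ = _ := by field_simp

/-- Equivalently `(x - 1) / log x` increases: the slopes of the secants of the concave `log` from
`1` decrease. -/
theorem log_ratio_mul_lt {p q : ℕ} (hq : 1 < q) (hqp : q < p) :
    ((q : ℝ) - 1) / 2 < Real.log q / Real.log p * (((p : ℝ) - 1) / 2) := by
  have hq1 : (1 : ℝ) < q := by exact_mod_cast hq
  have hpq : (q : ℝ) < p := by exact_mod_cast hqp
  have h := strictConcaveOn_log_Ioi.secant_strict_mono (a := 1) (x := q) (y := p)
    (by simp) (by simp; omega) (by simp; omega) hq1.ne' (hq1.trans hpq).ne' hpq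
  have hlp : 0 < Real.log p := Real.log_pos (hq1.trans hpq)
  rw [Real.log_one, sub_zero, sub_zero, div_lt_div_iff₀ (by linarith) (by linarith)] at h
  rw [div_mul_eq_mul_div, lt_div_iff₀ hlp]
  linarith

/-- For almost all `n`, the sum of digits in base `p` exceeds the one in a smaller base `q` by any
given constant. -/
theorem digits_sum_lt_density_zero {p q : ℕ} (hq : 1 < q) (hqp : q < p) (C : ℕ) :
    HasAsymptoticDensity {n | (Nat.digits p n).sum < (Nat.digits q n).sum + C} 0 := by
  have hp : 1 < p := hq.trans hqp
  have hq1 : (1 : ℝ) < q := by exact_mod_cast hq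
  have hpq : (q : ℝ) < p := by exact_mod_cast hqp
  have hlq : 0 < Real.log q := Real.log_pos hq1
  have hlp : Real.log q < Real.log p := Real.log_lt_log (by linarith) hpq
  have hmain := log_ratio_mul_lt hq hqp
  set θ := Real.log q / Real.log p with hθ
  have hθ0 : 0 < θ := div_pos hlq (hlq.trans hlp)
  have hθ1 : θ < 1 := (div_lt_one (hlq.trans hlp)).2 hlp
  set μp := ((p : ℝ) - 1) / 2 with hμp
  set μq := ((q : ℝ) - 1) / 2 with hμq
  have hμq0 : 0 < μq := by rw [hμq]; linarith
  have hμp0 : 0 < μp := by rw [hμp]; linarith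
  -- Of the gap `4 * η` per base-`q` digit, the two deviations use at most `2 * η`; the remaining `2
  -- * η * Kq` must absorb `C + μp`, which dictates `N` below.
  obtain ⟨η, hη⟩ : ∃ η, η = (θ * μp - μq) / 4 := ⟨_, rfl⟩
  have hη0 : 0 < η := by rw [hη]; linarith
  have hηp : η < μp := by rw [hη]; nlinarith
  have hlim : ∀ {b : ℕ}, 1 < b → Tendsto (fun X : ℕ => (b : ℝ) ^ 3 / η ^ 2 / (Nat.log b X + 1 : ℕ))
      atTop (𝓝 0) := by
    intro b hb
    refine Tendsto.const_div_atTop ?_ _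
    exact tendsto_natCast_atTop_atTop.comp
      ((tendsto_add_atTop_nat 1).comp (tendsto_natLog_atTop hb))
  have hlim2 := (hlim hp).add (hlim hq)
  rw [add_zero] at hlim2
  refine hasAsymptoticDensity_zero_of_le hlim2 ?_
  obtain ⟨N, hN⟩ := exists_nat_ge ((C + μp) / (2 * η))
  filter_upwards [eventually_gt_atTop 0, (tendsto_natLog_atTop hq).eventually_ge_atTop N]
    with X hX hXN
  rw [add_mul]
  refine le_trans ?_ (add_le_add (digits_sum_deviation_count hp hX.ne' hη0)
    (digits_sum_deviation_count hq hX.ne' hη0))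
  rw [← Nat.cast_add]
  refine Nat.cast_le.2 (le_trans ?_ (ncard_inter_Icc_union_le _ _ X))
  refine ncard_inter_Icc_mono fun n _ hn => ?_
  by_contra hcon
  rw [Set.mem_union, not_or, Set.mem_ofPred_eq, Set.mem_ofPred_eq, not_le, not_le, abs_lt,
    abs_lt] at hcon
  obtain ⟨⟨h1, -⟩, ⟨-, h2⟩⟩ := hcon
  rw [← hμp] at h1
  rw [← hμq] at h2
  have hn' : ((Nat.digits p n).sum : ℝ) < (Nat.digits q n).sum + C := by exact_mod_cast hn
  set Kp : ℝ := ((Nat.log p X + 1 : ℕ) : ℝ) with hKp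
  set Kq : ℝ := ((Nat.log q X + 1 : ℕ) : ℝ) with hKq
  have hKqN : (C + μp) / (2 * η) ≤ Kq := hN.trans (by rw [hKq]; exact_mod_cast hXN.trans (Nat.le_succ _))
  rw [div_le_iff₀ (by positivity)] at hKqN
  have hX0 : (0 : ℝ) < X := by exact_mod_cast hX
  have h3 : Real.log X ≤ Kp * Real.log p := by
    rw [hKp, ← Real.log_pow]
    exact Real.log_le_log hX0 (by exact_mod_cast (Nat.lt_pow_succ_log_self hp X).le)
  have h4 : (Kq - 1) * Real.log q ≤ Real.log X := by
    have : Kq - 1 = (Nat.log q X : ℕ) := by rw [hKq]; push_cast; ring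
    rw [this, ← Real.log_pow]
    exact Real.log_le_log (by positivity) (by exact_mod_cast Nat.pow_log_le_self q hX.ne')
  -- Comparison of the lengths of `X` in the two bases.
  have h5 : (Kq - 1) * θ ≤ Kp := by
    rw [hθ, ← mul_div_assoc, div_le_iff₀ (hlq.trans hlp)]
    exact h4.trans h3
  have h6 : (Kq - 1) * θ * (μp - η) ≤ Kp * (μp - η) :=
    mul_le_mul_of_nonneg_right h5 (by linarith)
  have hKq0 : 0 ≤ Kq := by positivity
  have h7 : Kq * (θ * μp) = Kq * (4 * η + μq) := by rw [hη]; ring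
  have h8 : Kq * (η * θ) ≤ Kq * η := by
    refine mul_le_mul_of_nonneg_left ?_ hKq0
    nlinarith
  have h9 : θ * μp ≤ μp := by nlinarith
  nlinarith [mul_pos hθ0 hη0]

theorem digits_sum_le_log_succ_mul {q : ℕ} (hq : 1 < q) (n : ℕ) :
    (Nat.digits q n).sum ≤ (Nat.log q n + 1) * q := by
  have h1 := List.sum_le_card_nsmul (Nat.digits q n) q fun d hd => (Nat.digits_lt_base hq hd).le
  rw [smul_eq_mul] at h1
  refine h1.trans (Nat.mul_le_mul_right q ?_)
  rw [Nat.digits_length_le_iff hq]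
  exact Nat.lt_pow_succ_log_self hq n

/-- The digit sum is only logarithmic in `n`; this suffices when `l * (q - 1) < p - 1`. -/
theorem eventually_mul_digits_sum_add_le {q : ℕ} (hq : 1 < q) (D E : ℕ) :
    ∀ᶠ n : ℕ in atTop, D * ((Nat.digits q n).sum + E) ≤ n := by
  have hq1 : (1 : ℝ) < q := by exact_mod_cast hq
  have h1 := (((tendsto_pow_const_div_const_pow_of_one_lt 1 hq1).const_mul (D * q : ℝ)).add
    ((tendsto_pow_const_div_const_pow_of_one_lt 0 hq1).const_mul (D * q + D * E : ℝ)))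
  simp only [mul_zero, add_zero, pow_one, pow_zero] at h1
  have h2 := (tendsto_natLog_atTop hq).eventually (h1.eventually_lt_const one_pos)
  filter_upwards [h2, eventually_gt_atTop 0] with n hn hn0
  have hpos : (0 : ℝ) < (q : ℝ) ^ Nat.log q n := by positivity
  rw [← mul_div_assoc, ← mul_div_assoc, ← add_div, div_lt_one hpos] at hn
  have h3 : D * q * Nat.log q n + (D * q + D * E) * 1 < q ^ Nat.log q n := by exact_mod_cast hn
  have h4 := Nat.pow_log_le_self q hn0.ne'
  have h5 := Nat.mul_le_mul_left D (Nat.add_le_add_right (digits_sum_le_log_succ_mul hq n) E)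
  nlinarith

/-! ### Valuations of factorials -/

/-- If `l * (q - 1) ≤ p - 1`, with `q < p` in the case of equality, then for almost all `n` the
`q`-adic valuation of `n!` is at least `l` times (`k` plus the `p`-adic valuation). -/
theorem factorial_factorization_density_zero {p q l : ℕ} (k : ℕ) (hp : p.Prime) (hq : q.Prime)
    (hle : l * (q - 1) ≤ p - 1) (heq : l * (q - 1) = p - 1 → q < p) :
    HasAsymptoticDensity {n : ℕ | ¬ l * (n.factorial.factorization p + k) ≤
      n.factorial.factorization q} 0 := by
  have hq0 : 0 < q - 1 := by have := hq.two_le; omega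
  have hleg : ∀ {r : ℕ}, r.Prime → ∀ n : ℕ,
      (r - 1) * n.factorial.factorization r + (Nat.digits r n).sum = n := by
    intro r hr n
    rw [Nat.sub_one_mul_factorization_factorial hr, Nat.sub_add_cancel (Nat.digit_sum_le r n)]
  rcases hle.eq_or_lt with h | h
  -- By Legendre's formula the claim becomes `s_q(n) + (p - 1) * k ≤ s_p(n)`.
  · refine (digits_sum_lt_density_zero hq.one_lt (heq h) ((p - 1) * k)).mono_zero ?_
    intro n hn
    by_contra hcon
    apply hn
    have hcon' : (Nat.digits q n).sum + (p - 1) * k ≤ (Nat.digits p n).sum := not_lt.1 hcon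
    refine Nat.le_of_mul_le_mul_left ?_ hq0
    have e1 := hleg hp n
    have e2 := hleg hq n
    have e3 : (q - 1) * (l * (n.factorial.factorization p + k)) =
        (p - 1) * n.factorial.factorization p + (p - 1) * k := by rw [← h]; ring
    omega
  -- With strict inequality there is a surplus of at least `x + k`, which outweighs the digit sum in
  -- base `q`; the exceptions are finite in number.
  · obtain ⟨N, hN⟩ := eventually_atTop.1
      (eventually_mul_digits_sum_add_le hq.one_lt (p - 1) (p * k))
    refine ((Set.finite_Iio N).hasAsymptoticDensity_zero).mono_zero ?_
    intro n hn
    by_contra hcon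
    apply hn
    have h1 := hN n (not_lt.1 hcon)
    refine Nat.le_of_mul_le_mul_left ?_ hq0
    have e1 := hleg hp n
    have e2 := hleg hq n
    set x := n.factorial.factorization p
    have h2 : (Nat.digits q n).sum + p * k ≤ x + (Nat.digits p n).sum := by
      have hp0 : 0 < p - 1 := by have := hp.two_le; omega
      refine Nat.le_of_mul_le_mul_left ?_ hp0
      have := Nat.mul_le_mul_right (Nat.digits p n).sum hp0
      nlinarith
    have e3 : (q - 1) * (l * (x + k)) = l * (q - 1) * (x + k) := by ring
    have e4 : (l * (q - 1) + 1) * (x + k) ≤ (p - 1) * (x + k) := Nat.mul_le_mul_right _ h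
    have e5 : (p - 1) * k ≤ p * k := Nat.mul_le_mul_right _ (Nat.sub_le p 1)
    rw [add_mul, one_mul, mul_add (p - 1)] at e4
    omega

/-! ### Digits from residues, and the conclusion -/

/-- If `b = p * u` with `u` prime to `p`, and `p ^ V * u ^ (V + k)` divides `m`, where `V` is the
`p`-adic valuation of `m`, then the last `k` nonzero digits of `m` in base `b` are determined by
their residues modulo `p ^ k` and `u ^ k`. -/
theorem lastNonzeroDigits_eq_iff {p u v k m a : ℕ} (hp : p.Prime) (hu : u.Coprime p)
    (huv : ((u : ℕ) : ZMod (p ^ k)) * (v : ZMod (p ^ k)) = 1) (hm : m ≠ 0)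
    (hdvd : u ^ (m.factorization p + k) ∣ m) (ha : a < (p * u) ^ k) :
    lastNonzeroDigits (p * u) k m = a ↔
      u ^ k ∣ a ∧ twistedUnitPart p k v m = (a : ZMod (p ^ k)) := by
  set V := m.factorization p with hV
  have hcop : (u ^ (V + k)).Coprime (p ^ V) := hu.pow _ _
  obtain ⟨c, hc⟩ := hcop.mul_dvd_of_dvd_of_dvd hdvd (Nat.ordProj_dvd m p)
  have hm1 : m = (p * u) ^ V * (u ^ k * c) := by rw [hc, mul_pow, pow_add]; ring
  have hord : ordCompl[p] m = u ^ V * (u ^ k * c) := by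
    apply Nat.div_eq_of_eq_mul_right (pow_pos hp.pos _)
    conv_lhs => rw [hm1]
    rw [mul_pow]; ring
  have hpu : 0 < p * u := by
    rcases Nat.eq_zero_or_pos u with rfl | h
    · simp at hu; exact absurd hu hp.one_lt.ne'
    · exact Nat.mul_pos hp.pos h
  have hmult : multiplicity (p * u) m = V := by
    refine multiplicity_eq_of_dvd_of_not_dvd ⟨_, hm1⟩ fun h => ?_
    have h1 : p ^ (V + 1) ∣ m := (pow_dvd_pow_of_dvd (Dvd.intro u rfl) _).trans h
    exact Nat.pow_succ_factorization_not_dvd hm hp h1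
  have hdiv : m / (p * u) ^ V = u ^ k * c := by
    conv_lhs => rw [hm1]
    rw [Nat.mul_div_cancel_left _ (pow_pos hpu V)]
  have htw : twistedUnitPart p k v m = ((u ^ k * c : ℕ) : ZMod (p ^ k)) := by
    rw [twistedUnitPart, hord, Nat.cast_mul, Nat.cast_pow, mul_right_comm, ← mul_pow, huv, one_pow,
      one_mul]
  rw [lastNonzeroDigits, hmult, hdiv, htw, ZMod.natCast_eq_natCast_iff]
  have h1 : u ^ k * c % (p * u) ^ k = a ↔ u ^ k * c ≡ a [MOD (p * u) ^ k] := by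
    rw [Nat.ModEq, Nat.mod_eq_of_lt ha]
  rw [h1, mul_pow, mul_comm (p ^ k),
    ← Nat.modEq_and_modEq_iff_modEq_mul (hu.pow k k)]
  refine and_congr_left fun _ => ?_
  rw [← Nat.modEq_zero_iff_dvd]
  have h2 : u ^ k * c ≡ 0 [MOD u ^ k] := Nat.modEq_zero_iff_dvd.2 (Dvd.intro c rfl)
  exact ⟨fun h => h.symm.trans h2, fun h => h2.trans h.symm⟩

/-- If `p` is the leading prime of `b`, of exponent one, then for almost all `n` the number
`(b / p) ^ (V + k)` divides `n!`, where `V` is the `p`-adic valuation of `n!`. -/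
theorem cofactor_pow_dvd_factorial_density {b p : ℕ} (k : ℕ) (hb : b ≠ 0) (hp : IsLeadingPrime b p)
    (hl : b.factorization p = 1) :
    HasAsymptoticDensity {n : ℕ | ¬ (b / p) ^ (n.factorial.factorization p + k) ∣ n.factorial}
      0 := by
  have hpp : p.Prime := Nat.prime_of_mem_primeFactors hp.mem
  refine (hasAsymptoticDensity_zero_biUnion (b.primeFactors.erase p)
    (fun q => {n : ℕ | ¬ b.factorization q * (n.factorial.factorization p + k) ≤
      n.factorial.factorization q}) fun q hq => ?_).mono_zero ?_
  · obtain ⟨hqp, hq⟩ := mem_erase.1 hq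
    have h1 := hp.le q hq
    have h2 := hp.max q hq
    rw [hl, one_mul] at h1 h2
    exact factorial_factorization_density_zero k hpp (Nat.prime_of_mem_primeFactors hq) h1
      fun h => lt_of_le_of_ne (h2 h) hqp
  · intro n hn
    by_contra hcon
    apply hn
    simp only [Set.mem_iUnion, not_exists, Set.mem_ofPred_eq, not_not] at hcon
    have hu0 : b / p ≠ 0 :=
      (Nat.div_pos (Nat.le_of_dvd hb.bot_lt (Nat.dvd_of_mem_primeFactors hp.mem)) hpp.pos).ne'
    rw [← Nat.factorization_le_iff_dvd (pow_ne_zero _ hu0) n.factorial_ne_zero]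
    intro q
    rw [Nat.factorization_pow, Nat.factorization_div (Nat.dvd_of_mem_primeFactors hp.mem),
      hpp.factorization]
    by_cases hqp : q = p
    · subst hqp
      simp [hl]
    · by_cases hqb : q ∈ b.primeFactors
      · have := hcon q (mem_erase.2 ⟨hqp, hqb⟩)
        simpa [Finsupp.single_apply, Ne.symm hqp, mul_comm] using this
      · have : b.factorization q = 0 := by
          rwa [← Finsupp.notMem_support_iff, Nat.support_factorization]
        simp [this]

theorem corollary2p3 (b k p₁ : ℕ) (hb : 2 ≤ b) (hk : 1 ≤ k)
    (hp₁ : IsLeadingPrime b p₁) (hl₁ : b.factorization p₁ = 1)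
    (a : ℕ) (ha1 : 1 ≤ a) (ha2 : a ≤ b ^ k - 1) (hba : ¬ b ∣ a) :
    ((b / p₁) ^ k ∣ a →
      HasFactorialDigitFrequency b k a (1 / (((p₁ : ℝ) - 1) * (p₁ : ℝ) ^ (k - 1)))) ∧
    (¬ (b / p₁) ^ k ∣ a → HasFactorialDigitFrequency b k a 0) := by
  have hb0 : b ≠ 0 := by omega
  have hp : p₁.Prime := Nat.prime_of_mem_primeFactors hp₁.mem
  have hnull := cofactor_pow_dvd_factorial_density k hb0 hp₁ hl₁
  have hbu : b = p₁ * (b / p₁) := (Nat.mul_div_cancel' (Nat.dvd_of_mem_primeFactors hp₁.mem)).symm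
  have hu : (b / p₁).Coprime p₁ := by
    have := Nat.coprime_ordCompl hp hb0
    rw [hl₁, pow_one] at this
    exact this.symm
  have : NeZero (p₁ ^ k) := ⟨pow_ne_zero k hp.ne_zero⟩
  set u := b / p₁
  obtain ⟨v, hvv⟩ : ∃ v : ℕ, (v : ZMod (p₁ ^ k)) = (u : ZMod (p₁ ^ k))⁻¹ :=
    ⟨((u : ZMod (p₁ ^ k))⁻¹).val, ZMod.natCast_zmod_val _⟩
  have huv : ((u : ℕ) : ZMod (p₁ ^ k)) * (v : ZMod (p₁ ^ k)) = 1 := by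
    rw [hvv]
    exact ZMod.coe_mul_inv_eq_one u (hu.pow_right k)
  have hv : v.Coprime p₁ :=
    ((ZMod.isUnit_iff_coprime v (p₁ ^ k)).1
      (IsUnit.of_mul_eq_one _ ((mul_comm _ _).trans huv))).coprime_dvd_right
      (dvd_pow_self p₁ (by omega))
  have halt : a < (p₁ * u) ^ k := by
    rw [← hbu]
    have := Nat.pow_pos (n := k) hb0.bot_lt
    omega
  have hiff : ∀ n : ℕ, n ∉ {n : ℕ | ¬ u ^ (n.factorial.factorization p₁ + k) ∣ n.factorial} →
      (lastNonzeroDigits b k n.factorial = a ↔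
        u ^ k ∣ a ∧ twistedUnitPart p₁ k v n.factorial = (a : ZMod (p₁ ^ k))) := by
    intro n hn
    rw [Set.mem_ofPred_eq, not_not] at hn
    have := lastNonzeroDigits_eq_iff hp hu huv n.factorial_ne_zero hn halt
    rwa [← hbu] at this
  refine ⟨fun hua => ?_, fun hua => ?_⟩
  -- Since `u ∣ a`, divisibility of `a` by `p₁` would give `b ∣ a`; so `a` is a unit modulo `p₁ ^
  -- k`.
  · have hap : a.Coprime p₁ := by
      refine ((hp.coprime_iff_not_dvd).2 fun h => hba ?_).symm
      rw [hbu]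
      exact hu.symm.mul_dvd_of_dvd_of_dvd h ((dvd_pow_self u (by omega)).trans hua)
    have hdens := hasAsymptoticDensity_twistedUnitPart (k := k) hp hv hk
      (natCast_isUnit_of_coprime hap)
    have hφ : (((p₁ ^ k).totient : ℕ) : ℝ) = ((p₁ : ℝ) - 1) * (p₁ : ℝ) ^ (k - 1) := by
      rw [Nat.totient_prime_pow hp hk, Nat.cast_mul, Nat.cast_pow, Nat.cast_sub hp.one_le,
        Nat.cast_one, mul_comm]
    rw [hφ] at hdens
    exact hdens.congr_off_null hnull fun n hn => (hiff n hn).trans (and_iff_right hua)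
  · exact Set.finite_empty.hasAsymptoticDensity_zero.congr_off_null hnull fun n hn =>
      (hiff n hn).trans (by simp [hua])
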